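/- Let $0\le n<N$ be integers, let $\zeta_j=e^{i\pi j/N}$ for $j=-N+1,\dots,N$, and let $\nu$ be the uniform probability measure on these $2N$ points. Let $\mathfrak P$ be the real vector space of symmetric trigonometric polynomials $P(z)=\sum_{k=-n}^n p_kz^{-k}$ with $p_{-k}=\bar p_k$ (so $p_0\in\mathbb R$), with its usual finite-dimensional topology, and let $\mathfrak P_+(N)=\{P\in\mathfrak P : P(\zeta_j)>0,\ j=-N+1,\dots,N\}$. Let $\mathfrak C_+(N)$ be the set of all $c=(c_0,\dots,c_n)\in\mathbb R\times\mathbb C^n$ such that, with $c_{-k}=\bar c_k$, $\sum_{k=-n}^n c_k\bar p_k>0$ for every nonzero $P$ in the closure of $\mathfrak P_+(N)$. 1. For each $P\in\mathfrak P_+(N)$, the moment map $$F^P:\mathfrak P_+(N)\to\mathfrak C_+(N),\qquad F^P_k(Q)=\int z^k\,\frac{P(z)}{Q(z)}\,d\nu(z)=\frac1{2N}\sum_{j=-N+1}^N\zeta_j^k\,\frac{P(\zeta_j)}{Q(\zeta_j)},\quad k=0,1,\dots,n,$$ is a homeomorphism onto $\mathfrak C_+(N)$. 2. For each $c\in\mathfrak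 C_+(N)$, let $G^c$ be the map sending $P\in\mathfrak P_+(N)$ to the unique $Q\in\mathfrak P_+(N)$ with $F^P(Q)=c$. Then $G^c$ is a homeomorphism of $\mathfrak P_+(N)$ onto the set $\{Q\in\mathfrak P_+(N) : F^P(Q)=c\text{ for some }P\in\mathfrak P_+(N)\}$ of all solutions for $c$. All of these sets are open (in $\mathfrak P$ and in $\mathbb R\times\mathbb C^n$, respectively), and $F^P$, $G^c$ and their inverses are $C^\infty$. In particular, for each $c\in\mathfrak C_+(N)$, $G^c$ is a complete smooth parameterization of all solutions $Q$ by $P\in\mathfrak P_+(N)$. -/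

import Mathlib

open Set
open scoped ContDiff ComplexConjugate

noncomputable section

/-- The real vector space of tuples `(p₀, p₁, …, pₙ)` with `p₀` real and `p₁, …, pₙ` complex.
It holds both the covariance data `(c₀, …, cₙ)` and the symmetric trigonometric polynomials
`P(z) = ∑_{k=-n}^n p_k z^{-k}`, `p_{-k} = conj p_k`, given by their coefficients. -/
abbrev HermCoeffs (n : ℕ) : Type := ℝ × (Fin n → ℂ)

/-- The two-sided coefficient sequence: `p_{-k} = conj p_k`, and `p_k = 0` for `|k| > n`. -/
def HermCoeffs.coeff {n : ℕ} (p : HermCoeffs n) (k : ℤ) : ℂ :=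
  if k = 0 then (p.1 : ℂ)
  else if h : k.natAbs - 1 < n then
    (if 0 < k then p.2 ⟨k.natAbs - 1, h⟩ else conj (p.2 ⟨k.natAbs - 1, h⟩))
  else 0

/-- `P(z) = ∑_{k=-n}^n p_k z^{-k}`. -/
def HermCoeffs.eval {n : ℕ} (p : HermCoeffs n) (z : ℂ) : ℂ :=
  ∑ k ∈ Finset.Icc (-(n : ℤ)) n, p.coeff k * z ^ (-k)

/-- The points `ζ_j = exp(i π j / N)` of the discrete unit circle `𝕋_{2N}`. -/
def zetaPt (N : ℕ) (j : ℤ) : ℂ := Complex.exp (Complex.I * (Real.pi * j / N))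

/-- The integral `∫ f dν = (1/2N) ∑_{j=-N+1}^N f(ζ_j)` against the uniform probability measure
on the discrete unit circle. -/
def discreteIntegral (N : ℕ) (f : ℂ → ℂ) : ℂ :=
  (1 / (2 * (N : ℂ))) * ∑ j ∈ Finset.Icc (-(N : ℤ) + 1) N, f (zetaPt N j)

/-- The cone `𝔓₊(N)`: `P(ζ_j) > 0` for `j = -N+1, …, N`. The values `P(ζ_j)` are real, see
`HermCoeffs.eval_im`. -/
def posCone (n N : ℕ) : Set (HermCoeffs n) :=
  {P | ∀ j ∈ Finset.Icc (-(N : ℤ) + 1) N, 0 < (P.eval (zetaPt N j)).re}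

/-- `⟨C, P⟩ = ∑_{k=-n}^n c_k conj p_k`, a real number, see `pairing_im`. -/
def pairing {n : ℕ} (c p : HermCoeffs n) : ℂ :=
  ∑ k ∈ Finset.Icc (-(n : ℤ)) n, c.coeff k * conj (p.coeff k)

/-- The (open) dual cone `ℭ₊(N)`: `⟨C, P⟩ > 0` for all nonzero `P` in the closure of `𝔓₊(N)`. -/
def dualCone (n N : ℕ) : Set (HermCoeffs n) :=
  {c | ∀ P ∈ closure (posCone n N), P ≠ 0 → 0 < (pairing c P).re}

/-- The moment `∫ e^{ikθ} P(e^{iθ}) / Q(e^{iθ}) dν`. -/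
def ratMoment {n : ℕ} (N : ℕ) (P Q : HermCoeffs n) (k : ℤ) : ℂ :=
  discreteIntegral N fun z => z ^ k * (P.eval z / Q.eval z)

/-- The moment map `F^P`, sending `Q` to the moments of `P / Q` for `k = 0, 1, …, n`. The zeroth
moment is real, see `ratMoment_zero_im`. -/
def momentMap {n : ℕ} (N : ℕ) (P Q : HermCoeffs n) : HermCoeffs n :=
  ((ratMoment N P Q 0).re, fun k : Fin n => ratMoment N P Q ((k : ℤ) + 1))

/-- The map `G^c`, sending `P` to the `Q ∈ 𝔓₊(N)` with `F^P(Q) = c`. -/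
def solutionMap (n N : ℕ) (c P : HermCoeffs n) : HermCoeffs n :=
  Function.invFunOn (momentMap N P) (posCone n N) c

/-- All solutions for the data `c`: those `Q ∈ 𝔓₊(N)` for which `P / Q` has the moments `c` for
some `P ∈ 𝔓₊(N)`. -/
def solutionSet (n N : ℕ) (c : HermCoeffs n) : Set (HermCoeffs n) :=
  {Q | Q ∈ posCone n N ∧ ∃ P ∈ posCone n N, momentMap N P Q = c}

theorem HermCoeffs.conj_coeff {n : ℕ} (p : HermCoeffs n) (k : ℤ) :
    conj (p.coeff k) = p.coeff (-k) := by
  unfold HermCoeffs.coeff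
  rcases lt_trichotomy k 0 with h | h | h
  · have h1 : ¬ (0 < k) := by omega
    have h2 : k ≠ 0 := by omega
    simp only [h1, h2, Int.natAbs_neg, neg_eq_zero, if_false]
    split_ifs <;> first | omega | simp
  · simp [h]
  · have h2 : k ≠ 0 := by omega
    simp only [h, h2, Int.natAbs_neg, neg_eq_zero, if_false, if_true]
    split_ifs <;> first | omega | simp

theorem sum_symm_Icc (n : ℕ) (f : ℤ → ℂ) :
    ∑ k ∈ Finset.Icc (-(n : ℤ)) n, f (-k) = ∑ k ∈ Finset.Icc (-(n : ℤ)) n, f k := by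
  refine Finset.sum_nbij' (fun k => -k) (fun k => -k) ?_ ?_ ?_ ?_ ?_ <;>
    intro k hk <;> simp at hk ⊢ <;> omega

theorem HermCoeffs.eval_im {n : ℕ} (p : HermCoeffs n) {z : ℂ} (hz : ‖z‖ = 1) :
    (p.eval z).im = 0 := by
  rw [← Complex.conj_eq_iff_im, HermCoeffs.eval, map_sum,
    ← sum_symm_Icc n (fun k => p.coeff k * z ^ (-k))]
  refine Finset.sum_congr rfl fun k _ => ?_
  rw [map_mul, p.conj_coeff, map_zpow₀, ← Complex.inv_eq_conj hz, inv_zpow', neg_neg]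

theorem pairing_im {n : ℕ} (c p : HermCoeffs n) : (pairing c p).im = 0 := by
  rw [← Complex.conj_eq_iff_im, pairing, map_sum,
    ← sum_symm_Icc n (fun k => c.coeff k * conj (p.coeff k))]
  refine Finset.sum_congr rfl fun k _ => ?_
  rw [map_mul, c.conj_coeff, p.conj_coeff k]

theorem norm_zetaPt (N : ℕ) (j : ℤ) : ‖zetaPt N j‖ = 1 := by
  have h : Complex.I * (Real.pi * j / N) = ((Real.pi * j / N : ℝ) : ℂ) * Complex.I := by
    push_cast; ring
  rw [zetaPt, h, Complex.norm_exp_ofReal_mul_I]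

theorem ratMoment_zero_im {n : ℕ} (N : ℕ) (P Q : HermCoeffs n) :
    (ratMoment N P Q 0).im = 0 := by
  rw [← Complex.conj_eq_iff_im, ratMoment, discreteIntegral, map_mul, map_sum]
  congr 1
  · rw [map_div₀, map_mul, map_one, Complex.conj_natCast, map_ofNat]
  · refine Finset.sum_congr rfl fun j _ => ?_
    have h1 := Complex.conj_eq_iff_im.2 (P.eval_im (norm_zetaPt N j))
    have h2 := Complex.conj_eq_iff_im.2 (Q.eval_im (norm_zetaPt N j))
    simp [h1, h2]

end

/-! Evaluation at the `2N` points embeds the polynomials into `ℝ^{2N}`, since `2n < 2N`, and the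
pairing turns the moments of `P / Q` into the functional `∑ j, (L j P / L j Q) • L j`, where `L j`
is the suitably scaled evaluation at `ζ_j`. Both this functional as a function of `P` and its
derivative in `Q` are Gram operators `x ↦ ∑ j, (a j * L j x) • L j` with weights of one sign, hence
definite and invertible. This gives injectivity, smooth inverses by the inverse function theorem,
and `P` as a smooth function of `Q` and `c`. Surjectivity is variational: on the compact slice of
the closed cone where `c` takes the value `∑ j, L j P`, the function `∏ j, (L j Q) ^ L j P` has a
maximum in the open cone, and there the Lagrange condition reads
`c = ∑ j, (L j P / L j Q) • L j`. -/

noncomputable section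

open Filter Topology

section Diffeo

variable {𝕜 E F G : Type*} [RCLike 𝕜] [NormedAddCommGroup E] [NormedSpace 𝕜 E]
  [NormedAddCommGroup F] [NormedSpace 𝕜 F] [NormedAddCommGroup G] [NormedSpace 𝕜 G]

variable (𝕜) in
/-- `f` restricts to a `C^m` diffeomorphism from the open set `s` onto the open set `t`. The values
of `f` outside `s` are irrelevant. -/
def IsContDiffDiffeoOn (m : WithTop ℕ∞) (f : E → F) (s : Set E) (t : Set F) : Prop :=
  ∃ e : OpenPartialHomeomorph E F, e.source = s ∧ e.target = t ∧ (∀ x ∈ s, e x = f x) ∧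
    ContDiffOn 𝕜 m e e.source ∧ ContDiffOn 𝕜 m e.symm e.target

namespace IsContDiffDiffeoOn

variable {m : WithTop ℕ∞} {f : E → F} {s : Set E} {t : Set F}

theorem of_injOn [CompleteSpace E] (hm : m ≠ 0) (hs : IsOpen s) (hinj : InjOn f s)
    (hf : ∀ x ∈ s, ContDiffAt 𝕜 m f x) (hf' : ∀ x ∈ s, (fderiv 𝕜 f x).IsInvertible) :
    IsContDiffDiffeoOn 𝕜 m f s (f '' s) := by
  have hcont : ContDiffOn 𝕜 m f s := fun x hx => (hf x hx).contDiffWithinAt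
  have hopen : IsOpenMap (s.domRestrict f) := by
    refine IsOpenMap.of_nhds_le fun x => ?_
    obtain ⟨g, hg⟩ := hf' x x.2
    have hstrict := (hf x x.2).hasStrictFDerivAt hm
    rw [← hg] at hstrict
    rw [domRestrict_apply, ← hstrict.map_nhds_eq_of_equiv,
      ← map_nhds_subtype_coe_eq_nhds x.2 (hs.mem_nhds x.2), map_map]
    rfl
  set e := OpenPartialHomeomorph.ofContinuousOpenRestrict (hinj.toPartialEquiv f s)
    hcont.continuousOn hopen hs
  refine ⟨e, rfl, rfl, fun _ _ => rfl, hcont, fun y hy => ?_⟩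
  have hx : e.symm y ∈ s := e.map_target hy
  obtain ⟨g, hg⟩ := hf' _ hx
  have hderiv := ((hf _ hx).differentiableAt hm).hasFDerivAt
  rw [← hg] at hderiv
  exact (e.contDiffAt_symm hy hderiv (hf _ hx)).contDiffWithinAt

theorem of_equiv_comp (T : F ≃L[𝕜] G) {t : Set G} (h : IsContDiffDiffeoOn 𝕜 m (T ∘ f) s t) :
    IsContDiffDiffeoOn 𝕜 m f s (T ⁻¹' t) := by
  obtain ⟨e, rfl, rfl, hef, he, he'⟩ := h
  refine ⟨e.transHomeomorph T.symm.toHomeomorph, rfl, rfl, fun x hx => ?_,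
    T.symm.contDiff.comp_contDiffOn he, he'.comp T.contDiff.contDiffOn fun _ => id⟩
  exact T.symm_apply_eq.2 (hef x hx)

theorem of_rightInverse (h : IsContDiffDiffeoOn 𝕜 m f s t) {g : F → E} (hmaps : MapsTo g t s)
    (hright : RightInvOn g f t) : IsContDiffDiffeoOn 𝕜 m g t s := by
  obtain ⟨e, rfl, rfl, hef, he, he'⟩ := h
  refine ⟨e.symm, rfl, rfl, fun y hy => ?_, he', he⟩
  exact ((e.eq_symm_apply (hmaps hy) hy).2 ((hef _ (hmaps hy)).trans (hright hy))).symm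

theorem bijOn (h : IsContDiffDiffeoOn 𝕜 m f s t) : BijOn f s t := by
  obtain ⟨e, rfl, rfl, hef, -⟩ := h
  exact e.bijOn.congr hef

end IsContDiffDiffeoOn

end Diffeo

section Cone

variable {E : Type*} [NormedAddCommGroup E] [NormedSpace ℝ E]

/-- The continuous functionals which are strictly positive on the closure of `K`, except at `0`. For
a cone `K` in a finite-dimensional space this is the interior of the dual cone. -/
def strictDual (K : Set E) : Set (StrongDual ℝ E) :=
  {φ | ∀ x ∈ closure K, x ≠ 0 → 0 < φ x}

variable {K : Set E} {φ : StrongDual ℝ E}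

theorem smul_mem_closure_of_pos (hK : ∀ t : ℝ, 0 < t → MapsTo (t • ·) K K) {t : ℝ} (ht : 0 < t)
    {x : E} (hx : x ∈ closure K) : t • x ∈ closure K :=
  (hK t ht).closure (continuous_const_smul t) hx

variable [FiniteDimensional ℝ E]

theorem exists_mul_norm_le_of_mem_strictDual (hK : ∀ t : ℝ, 0 < t → MapsTo (t • ·) K K)
    (hφ : φ ∈ strictDual K) : ∃ ε > 0, ∀ x ∈ closure K, ε * ‖x‖ ≤ φ x := by
  have : ProperSpace E := FiniteDimensional.proper ℝ E
  have hcompact : IsCompact (closure K ∩ Metric.sphere 0 1) :=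
    (isCompact_sphere 0 1).inter_left isClosed_closure
  obtain ⟨ε, hε, hle⟩ : ∃ ε > 0, ∀ x ∈ closure K ∩ Metric.sphere 0 1, ε ≤ φ x :=
    hcompact.exists_forall_le' φ.continuous.continuousOn fun x hx =>
      hφ x hx.1 (Metric.ne_of_mem_sphere hx.2 one_ne_zero)
  refine ⟨ε, hε, fun x hx => ?_⟩
  rcases eq_or_ne x 0 with rfl | hx0
  · simp
  have hnorm : 0 < ‖x‖ := norm_pos_iff.2 hx0
  have hunit := hle (‖x‖⁻¹ • x)
    ⟨smul_mem_closure_of_pos hK (inv_pos.2 hnorm) hx, by simp [norm_smul, hnorm.ne']⟩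
  rwa [map_smul, smul_eq_mul, inv_mul_eq_div, le_div_iff₀ hnorm] at hunit

theorem isCompact_closure_inter_preimage_singleton (hK : ∀ t : ℝ, 0 < t → MapsTo (t • ·) K K)
    (hφ : φ ∈ strictDual K) (a : ℝ) : IsCompact (closure K ∩ φ ⁻¹' {a}) := by
  have : ProperSpace E := FiniteDimensional.proper ℝ E
  obtain ⟨ε, hε, hle⟩ := exists_mul_norm_le_of_mem_strictDual hK hφ
  refine (isCompact_closedBall (0 : E) (a / ε)).of_isClosed_subset
    (isClosed_closure.inter (isClosed_singleton.preimage φ.continuous)) fun x hx => ?_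
  rw [mem_closedBall_zero_iff, le_div_iff₀' hε]
  exact (hle x hx.1).trans_eq hx.2

theorem isInvertible_of_forall_apply_self_eq_zero (B : E →L[ℝ] StrongDual ℝ E)
    (hB : ∀ x, B x x = 0 → x = 0) : B.IsInvertible := by
  have hinj : Function.Injective (B : E →ₗ[ℝ] StrongDual ℝ E) :=
    (injective_iff_map_eq_zero _).2 fun x hx => hB x (by rw [show B x = 0 from hx, zero_apply])
  have hrank : Module.finrank ℝ E = Module.finrank ℝ (StrongDual ℝ E) :=
    Subspace.dual_finrank_eq.symm.trans LinearMap.toContinuousLinearMap.finrank_eq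
  exact ⟨(LinearEquiv.ofInjectiveOfFinrankEq _ hinj hrank).toContinuousLinearEquiv, rfl⟩

end Cone

section Moments

variable {ι E : Type*} [NormedAddCommGroup E] [NormedSpace ℝ E] (L : ι → StrongDual ℝ E)

/-- The open polyhedral cone on which all the functionals `L j` are positive. -/
def positiveCone : Set E := {x | ∀ j, 0 < L j x}

theorem smul_mem_positiveCone (t : ℝ) (ht : 0 < t) :
    MapsTo (t • ·) (positiveCone L) (positiveCone L) := fun x hx j => by
  rw [map_smul]
  exact mul_pos ht (hx j)

theorem isOpen_positiveCone [Finite ι] : IsOpen (positiveCone L) := by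
  simp only [positiveCone, ofPred_forall]
  exact isOpen_iInter_of_finite fun j => isOpen_lt continuous_const (L j).continuous

variable {L} in
theorem nonneg_of_mem_closure_positiveCone {x : E} (hx : x ∈ closure (positiveCone L)) (j : ι) :
    0 ≤ L j x :=
  closure_minimal (fun _ hy => (hy j).le) (isClosed_Ici.preimage (L j).continuous) hx

variable [Fintype ι]

/-- The operator `E → E*` of the symmetric bilinear form `(x, y) ↦ ∑ j, a j * L j x * L j y`. -/
def gramOperator (a : ι → ℝ) : E →L[ℝ] StrongDual ℝ E := ∑ j, a j • (L j).smulRight (L j)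

theorem gramOperator_apply (a : ι → ℝ) (x : E) :
    gramOperator L a x = ∑ j, (a j * L j x) • L j := by
  simp [gramOperator, smul_smul]

/-- The functional `R ↦ ∑ j, (L j P / L j Q) * L j R`. When the `L j` are point evaluations, it
integrates `R` against the density `P / Q`. -/
def momentFunctional (P Q : E) : StrongDual ℝ E := ∑ j, (L j P / L j Q) • L j

theorem gramOperator_inv_apply (P Q : E) :
    gramOperator L (fun j => (L j Q)⁻¹) P = momentFunctional L P Q := by
  simp only [gramOperator_apply, momentFunctional, div_eq_inv_mul]

theorem momentFunctional_apply_self (P : E) {Q : E} (hQ : Q ∈ positiveCone L) :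
    momentFunctional L P Q Q = ∑ j, L j P := by
  simp [momentFunctional, fun j => (hQ j).ne']

theorem contDiffAt_gramOperator_inv {Q : E} (hQ : Q ∈ positiveCone L) {m : WithTop ℕ∞} :
    ContDiffAt ℝ m (fun Q => gramOperator L fun j => (L j Q)⁻¹) Q :=
  ContDiffAt.sum fun j _ =>
    .continuousLinearMap_comp (.toSpanSingleton ℝ ((L j).smulRight (L j)))
      ((L j).contDiff.contDiffAt.inv (hQ j).ne')

theorem contDiffAt_momentFunctional (P : E) {Q : E} (hQ : Q ∈ positiveCone L) {m : WithTop ℕ∞} :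
    ContDiffAt ℝ m (momentFunctional L P) Q := by
  simpa only [gramOperator_inv_apply] using
    (contDiffAt_gramOperator_inv L hQ).clm_apply (contDiffAt_const (c := P))

theorem hasFDerivAt_momentFunctional (P : E) {Q : E} (hQ : Q ∈ positiveCone L) :
    HasFDerivAt (momentFunctional L P) (-gramOperator L fun j => L j P / L j Q ^ 2) Q := by
  have hterm (j : ι) : HasFDerivAt (fun Q => (L j P / L j Q) • L j)
      ((L j P • -(L j Q ^ 2)⁻¹ • L j).smulRight (L j)) Q :=
    (((hasDerivAt_inv (hQ j).ne').comp_hasFDerivAt Q (L j).hasFDerivAt).const_smul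
      (L j P)).smul_const (L j)
  refine (HasFDerivAt.fun_sum fun j _ => hterm j).congr_fderiv ?_
  ext x y
  simp [gramOperator_apply, div_eq_mul_inv, mul_assoc]

theorem hasStrictFDerivAt_sum_mul_log (P : E) {Q : E} (hQ : Q ∈ positiveCone L) :
    HasStrictFDerivAt (fun R => ∑ j, L j P * Real.log (L j R)) (momentFunctional L P Q) Q := by
  refine (HasStrictFDerivAt.fun_sum fun j _ =>
    ((L j).hasStrictFDerivAt.log (hQ j).ne').const_mul (L j P)).congr_fderiv ?_
  simp only [momentFunctional, div_eq_mul_inv, smul_smul]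

theorem exists_isMaxOn_sum_mul_log [FiniteDimensional ℝ E] {p : ι → ℝ} (hp : ∀ j, 0 < p j)
    {φ : StrongDual ℝ E} (hφ : φ ∈ strictDual (positiveCone L)) {Q₀ : E}
    (hQ₀ : Q₀ ∈ positiveCone L) :
    ∃ Q ∈ positiveCone L ∩ φ ⁻¹' {φ Q₀},
      IsMaxOn (fun R => ∑ j, p j * Real.log (L j R)) (positiveCone L ∩ φ ⁻¹' {φ Q₀}) Q := by
  -- Unlike its logarithm, the product is continuous on the closed cone, and it vanishes exactly on
  -- the boundary.
  let f : E → ℝ := fun R => ∏ j, L j R ^ p j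
  have hf : Continuous f := continuous_finsetProd _ fun j _ =>
    (L j).continuous.rpow_const fun _ => Or.inr (hp j).le
  have hpos {R : E} (hR : R ∈ positiveCone L) : 0 < f R :=
    Finset.prod_pos fun j _ => Real.rpow_pos_of_pos (hR j) _
  have hlog {R : E} (hR : R ∈ positiveCone L) :
      Real.log (f R) = ∑ j, p j * Real.log (L j R) := by
    rw [Real.log_prod fun j _ => (Real.rpow_pos_of_pos (hR j) _).ne']
    exact Finset.sum_congr rfl fun j _ => Real.log_rpow (hR j) _
  obtain ⟨Q, ⟨hQcl, hQφ⟩, hmax⟩ :=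
    (isCompact_closure_inter_preimage_singleton (smul_mem_positiveCone L) hφ (φ Q₀)).exists_isMaxOn
      ⟨Q₀, subset_closure hQ₀, rfl⟩ hf.continuousOn
  have hfQ : 0 < f Q := (hpos hQ₀).trans_le (hmax ⟨subset_closure hQ₀, rfl⟩)
  have hQ : Q ∈ positiveCone L := fun j => by
    refine (nonneg_of_mem_closure_positiveCone hQcl j).lt_of_ne' fun hzero => hfQ.ne' ?_
    exact Finset.prod_eq_zero (Finset.mem_univ j) (by rw [hzero, Real.zero_rpow (hp j).ne'])
  refine ⟨Q, ⟨hQ, hQφ⟩, fun R hR => ?_⟩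
  simpa only [mem_ofPred_eq, hlog hR.1, hlog hQ] using
    Real.log_le_log (hpos hR.1) (hmax ⟨subset_closure hR.1, hR.2⟩)

theorem momentFunctional_eq_of_isMaxOn [CompleteSpace E] {P Q : E} {φ : StrongDual ℝ E}
    (hQ : Q ∈ positiveCone L) (hφQ : φ Q = ∑ j, L j P) (hφQ0 : φ Q ≠ 0)
    (hmax : IsMaxOn (fun R => ∑ j, L j P * Real.log (L j R))
      (positiveCone L ∩ φ ⁻¹' {φ Q}) Q) :
    momentFunctional L P Q = φ := by
  have hextr : IsLocalExtrOn (fun R => ∑ j, L j P * Real.log (L j R)) {R | φ R = φ Q} Q := by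
    refine Or.inr ?_
    filter_upwards [inter_mem_nhdsWithin _ ((isOpen_positiveCone L).mem_nhds hQ)] with R hR
    exact hmax ⟨hR.2, hR.1⟩
  obtain ⟨a, b, hab, hLagrange⟩ := hextr.exists_multipliers_of_hasStrictFDerivAt_1d
    φ.hasStrictFDerivAt (hasStrictFDerivAt_sum_mul_log L P hQ)
  have hb : b = -a := by
    have hQeq := congrArg (fun ψ : StrongDual ℝ E => ψ Q) hLagrange
    simp only [add_apply, smul_apply, zero_apply, smul_eq_mul,
      momentFunctional_apply_self L P hQ, ← hφQ, ← add_mul] at hQeq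
    linarith [(mul_eq_zero.1 hQeq).resolve_right hφQ0]
  have ha : a ≠ 0 := by
    rintro rfl
    simp [hb] at hab
  ext R
  have hR := congrArg (fun ψ : StrongDual ℝ E => ψ R) hLagrange
  simp only [add_apply, smul_apply, zero_apply, smul_eq_mul, hb] at hR
  exact mul_left_cancel₀ ha (by linarith)

variable {L} (hL : ∀ x, (∀ j, L j x = 0) → x = 0)

include hL

theorem eq_zero_of_gramOperator_apply_self {a : ι → ℝ} (ha : ∀ j, 0 < a j) {x : E}
    (hx : gramOperator L a x x = 0) : x = 0 := by
  have hsum : ∑ j, a j * (L j x * L j x) = 0 := by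
    simpa [gramOperator_apply, mul_assoc] using hx
  rw [Finset.sum_eq_zero_iff_of_nonneg fun j _ => mul_nonneg (ha j).le (mul_self_nonneg _)] at hsum
  exact hL x fun j => by simpa [(ha j).ne'] using hsum j (Finset.mem_univ j)

theorem momentFunctional_mem_strictDual {P Q : E} (hP : P ∈ positiveCone L)
    (hQ : Q ∈ positiveCone L) : momentFunctional L P Q ∈ strictDual (positiveCone L) := by
  intro R hR hR0
  have hRnonneg := nonneg_of_mem_closure_positiveCone hR
  obtain ⟨j, hj⟩ : ∃ j, L j R ≠ 0 := by
    contrapose! hR0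
    exact hL R hR0
  have hpos := Finset.sum_pos' (s := Finset.univ)
    (fun i _ => mul_nonneg (div_pos (hP i) (hQ i)).le (hRnonneg i))
    ⟨j, Finset.mem_univ j, mul_pos (div_pos (hP j) (hQ j)) ((hRnonneg j).lt_of_ne' hj)⟩
  simpa [momentFunctional] using hpos

theorem injOn_momentFunctional {P : E} (hP : P ∈ positiveCone L) :
    InjOn (momentFunctional L P) (positiveCone L) := by
  intro Q hQ Q' hQ' hQQ'
  have hdiff : gramOperator L (fun j => L j P / (L j Q * L j Q')) (Q' - Q) =
      momentFunctional L P Q - momentFunctional L P Q' := by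
    ext R
    simp only [gramOperator_apply, momentFunctional, sub_apply, sum_apply, smul_apply, smul_eq_mul,
      map_sub, ← Finset.sum_sub_distrib]
    refine Finset.sum_congr rfl fun j _ => ?_
    have := (hQ j).ne'
    have := (hQ' j).ne'
    field_simp
  refine (sub_eq_zero.1 (eq_zero_of_gramOperator_apply_self hL
    (fun j => div_pos (hP j) (mul_pos (hQ j) (hQ' j))) ?_)).symm
  rw [hdiff, hQQ', sub_self, zero_apply]

variable [FiniteDimensional ℝ E]

theorem isInvertible_gramOperator {a : ι → ℝ} (ha : ∀ j, 0 < a j) :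
    (gramOperator L a).IsInvertible :=
  isInvertible_of_forall_apply_self_eq_zero _ fun _ => eq_zero_of_gramOperator_apply_self hL ha

theorem isInvertible_fderiv_momentFunctional {P Q : E} (hP : P ∈ positiveCone L)
    (hQ : Q ∈ positiveCone L) : (fderiv ℝ (momentFunctional L P) Q).IsInvertible := by
  rw [(hasFDerivAt_momentFunctional L P hQ).fderiv]
  obtain ⟨g, hg⟩ := isInvertible_gramOperator hL fun j => div_pos (hP j) (pow_pos (hQ j) 2)
  exact ⟨g.trans (ContinuousLinearEquiv.neg ℝ), by rw [← hg]; rfl⟩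

theorem surjOn_momentFunctional {P : E} (hP : P ∈ positiveCone L) :
    SurjOn (momentFunctional L P) (positiveCone L) (strictDual (positiveCone L)) := by
  intro φ hφ
  have : CompleteSpace E := FiniteDimensional.complete ℝ E
  rcases subsingleton_or_nontrivial E with _ | _
  · exact ⟨P, hP, ContinuousLinearMap.ext fun x => by simp [Subsingleton.elim x 0]⟩
  obtain ⟨x, hx⟩ := exists_ne (0 : E)
  obtain ⟨i, -⟩ : ∃ i, L i x ≠ 0 := by
    contrapose! hx
    exact hL x hx
  have hsum : 0 < ∑ j, L j P := Finset.sum_pos (fun j _ => hP j) ⟨i, Finset.mem_univ i⟩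
  have hP0 : P ≠ 0 := by
    rintro rfl
    simpa using hP i
  have hφP : 0 < φ P := hφ P (subset_closure hP) hP0
  have hnormalize : φ (((∑ j, L j P) / φ P) • P) = ∑ j, L j P := by
    rw [map_smul, smul_eq_mul, div_mul_cancel₀ _ hφP.ne']
  obtain ⟨Q, ⟨hQ, hφQ⟩, hmax⟩ := exists_isMaxOn_sum_mul_log L hP hφ
    (smul_mem_positiveCone L _ (div_pos hsum hφP) hP)
  rw [← show φ Q = _ from hφQ] at hmax
  replace hφQ : φ Q = ∑ j, L j P := hφQ.trans hnormalize
  exact ⟨Q, hQ, momentFunctional_eq_of_isMaxOn L hQ hφQ (hφQ ▸ hsum.ne') hmax⟩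

theorem bijOn_momentFunctional {P : E} (hP : P ∈ positiveCone L) :
    BijOn (momentFunctional L P) (positiveCone L) (strictDual (positiveCone L)) :=
  ⟨fun _ hQ => momentFunctional_mem_strictDual hL hP hQ, injOn_momentFunctional hL hP,
    surjOn_momentFunctional hL hP⟩

theorem isContDiffDiffeoOn_momentFunctional {m : WithTop ℕ∞} (hm : m ≠ 0) {P : E}
    (hP : P ∈ positiveCone L) :
    IsContDiffDiffeoOn ℝ m (momentFunctional L P) (positiveCone L)
      (strictDual (positiveCone L)) := by
  have : CompleteSpace E := FiniteDimensional.complete ℝ E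
  rw [← (bijOn_momentFunctional hL hP).image_eq]
  exact .of_injOn hm (isOpen_positiveCone L) (injOn_momentFunctional hL hP)
    (fun _ hQ => contDiffAt_momentFunctional L P hQ)
    fun _ => isInvertible_fderiv_momentFunctional hL hP

omit hL [FiniteDimensional ℝ E] in
variable (L) in
/-- The numerator `P` for which `momentFunctional L P Q` is `φ`. -/
def momentNumerator (φ : StrongDual ℝ E) (Q : E) : E :=
  (gramOperator L fun j => (L j Q)⁻¹).inverse φ

theorem momentNumerator_eq_iff {Q : E} (hQ : Q ∈ positiveCone L) {φ : StrongDual ℝ E} {P : E} :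
    momentNumerator L φ Q = P ↔ momentFunctional L P Q = φ := by
  rw [momentNumerator,
    (isInvertible_gramOperator hL fun j => inv_pos.2 (hQ j)).inverse_apply_eq,
    gramOperator_inv_apply, eq_comm]

theorem contDiffAt_momentNumerator (φ : StrongDual ℝ E) {Q : E} (hQ : Q ∈ positiveCone L)
    {m : WithTop ℕ∞} : ContDiffAt ℝ m (momentNumerator L φ) Q := by
  have : CompleteSpace E := FiniteDimensional.complete ℝ E
  obtain ⟨g, hg⟩ := isInvertible_gramOperator hL fun j => inv_pos.2 (hQ j)
  have hinverse : ContDiffAt ℝ m ContinuousLinearMap.inverse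
      (gramOperator L fun j => (L j Q)⁻¹) := hg ▸ contDiffAt_map_inverse g
  exact (hinverse.comp Q (contDiffAt_gramOperator_inv L hQ)).clm_apply contDiffAt_const

theorem gramOperator_inv_comp_fderiv_momentNumerator (φ : StrongDual ℝ E) {Q : E}
    (hQ : Q ∈ positiveCone L) :
    (gramOperator L fun j => (L j Q)⁻¹) ∘L fderiv ℝ (momentNumerator L φ) Q =
      gramOperator L fun j => L j (momentNumerator L φ Q) / L j Q ^ 2 := by
  set A : E → E →L[ℝ] StrongDual ℝ E := fun R => gramOperator L fun j => (L j R)⁻¹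
  have hA : HasFDerivAt A (fderiv ℝ A Q) Q :=
    ((contDiffAt_gramOperator_inv L hQ (m := 1)).differentiableAt one_ne_zero).hasFDerivAt
  have hnum : HasFDerivAt (momentNumerator L φ) (fderiv ℝ (momentNumerator L φ) Q) Q :=
    ((contDiffAt_momentNumerator hL φ hQ (m := 1)).differentiableAt one_ne_zero).hasFDerivAt
  have hflip (P : E) : (fderiv ℝ A Q).flip P = -gramOperator L fun j => L j P / L j Q ^ 2 := by
    have hAP : HasFDerivAt (fun R => A R P) ((fderiv ℝ A Q).flip P) Q := by
      simpa using hA.clm_apply (hasFDerivAt_const P Q)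
    simp only [A, gramOperator_inv_apply] at hAP
    exact hAP.unique (hasFDerivAt_momentFunctional L P hQ)
  have hconst : (fun R => A R (momentNumerator L φ R)) =ᶠ[𝓝 Q] fun _ => φ := by
    filter_upwards [(isOpen_positiveCone L).mem_nhds hQ] with R hR
    rw [gramOperator_inv_apply, ← momentNumerator_eq_iff hL hR]
  have hderiv := (hA.clm_apply hnum).unique ((hasFDerivAt_const φ Q).congr_of_eventuallyEq hconst)
  rwa [hflip, ← sub_eq_add_neg, sub_eq_zero] at hderiv

theorem isInvertible_fderiv_momentNumerator {φ : StrongDual ℝ E} {Q : E} (hQ : Q ∈ positiveCone L)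
    (hP : momentNumerator L φ Q ∈ positiveCone L) :
    (fderiv ℝ (momentNumerator L φ) Q).IsInvertible := by
  obtain ⟨g, hg⟩ := isInvertible_gramOperator hL fun j => inv_pos.2 (hQ j)
  rw [← ContinuousLinearMap.isInvertible_equiv_comp (e := g), hg,
    gramOperator_inv_comp_fderiv_momentNumerator hL φ hQ]
  exact isInvertible_gramOperator hL fun j => div_pos (hP j) (pow_pos (hQ j) 2)

theorem isContDiffDiffeoOn_momentNumerator {m : WithTop ℕ∞} (hm : m ≠ 0) {φ : StrongDual ℝ E}
    (hφ : φ ∈ strictDual (positiveCone L)) :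
    IsContDiffDiffeoOn ℝ m (momentNumerator L φ)
      {Q | Q ∈ positiveCone L ∧ ∃ P ∈ positiveCone L, momentFunctional L P Q = φ}
      (positiveCone L) := by
  have : CompleteSpace E := FiniteDimensional.complete ℝ E
  set S := {Q | Q ∈ positiveCone L ∧ ∃ P ∈ positiveCone L, momentFunctional L P Q = φ}
  have hS : S = positiveCone L ∩ momentNumerator L φ ⁻¹' positiveCone L := by
    ext Q
    refine and_congr_right fun hQ => ?_
    simp [← momentNumerator_eq_iff hL hQ]
  have hopen : IsOpen S := hS ▸ ContinuousOn.isOpen_inter_preimage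
    (fun Q hQ => (contDiffAt_momentNumerator hL φ hQ (m := 0)).continuousAt.continuousWithinAt)
    (isOpen_positiveCone L) (isOpen_positiveCone L)
  have hinj : InjOn (momentNumerator L φ) S := by
    rintro Q ⟨hQ, P, hP, hPQ⟩ Q' ⟨hQ', -⟩ hQQ'
    rw [(momentNumerator_eq_iff hL hQ).2 hPQ] at hQQ'
    exact injOn_momentFunctional hL hP hQ hQ'
      (hPQ.trans ((momentNumerator_eq_iff hL hQ').1 hQQ'.symm).symm)
  have himage : momentNumerator L φ '' S = positiveCone L := by
    refine Subset.antisymm (image_subset_iff.2 (hS ▸ inter_subset_right)) fun P hP => ?_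
    obtain ⟨Q, hQ, hPQ⟩ := surjOn_momentFunctional hL hP hφ
    exact ⟨Q, ⟨hQ, P, hP, hPQ⟩, (momentNumerator_eq_iff hL hQ).2 hPQ⟩
  rw [← himage]
  refine .of_injOn hm hopen hinj (fun Q hQ => contDiffAt_momentNumerator hL φ hQ.1)
    fun Q hQ => isInvertible_fderiv_momentNumerator hL hQ.1 ?_
  exact (hS.subset hQ).2

theorem isContDiffDiffeoOn_of_momentFunctional_eq {m : WithTop ℕ∞} (hm : m ≠ 0)
    {φ : StrongDual ℝ E} (hφ : φ ∈ strictDual (positiveCone L)) {G : E → E}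
    (hG : ∀ P ∈ positiveCone L, G P ∈ positiveCone L ∧ momentFunctional L P (G P) = φ) :
    IsContDiffDiffeoOn ℝ m G (positiveCone L)
      {Q | Q ∈ positiveCone L ∧ ∃ P ∈ positiveCone L, momentFunctional L P Q = φ} :=
  (isContDiffDiffeoOn_momentNumerator hL hm hφ).of_rightInverse
    (fun P hP => ⟨(hG P hP).1, P, hP, (hG P hP).2⟩)
    fun P hP => (momentNumerator_eq_iff hL (hG P hP).1).2 (hG P hP).2

end Moments

namespace HermCoeffs

variable {n : ℕ}

theorem coeff_add (p q : HermCoeffs n) (k : ℤ) : (p + q).coeff k = p.coeff k + q.coeff k := by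
  unfold coeff
  split_ifs <;> simp

theorem coeff_smul (a : ℝ) (p : HermCoeffs n) (k : ℤ) : (a • p).coeff k = a * p.coeff k := by
  unfold coeff
  split_ifs <;> simp

theorem coeff_zero_index (p : HermCoeffs n) : p.coeff 0 = p.1 := if_pos rfl

theorem coeff_natCast_add_one (p : HermCoeffs n) (i : Fin n) : p.coeff ((i : ℤ) + 1) = p.2 i := by
  have hpos : (0 : ℤ) < i + 1 := by omega
  have habs : ((i : ℤ) + 1).natAbs = i + 1 := by omega
  simp [coeff, hpos, hpos.ne', habs]

theorem eq_zero_of_coeff_eq_zero {p : HermCoeffs n}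
    (hp : ∀ k ∈ Finset.Icc (-(n : ℤ)) n, p.coeff k = 0) : p = 0 := by
  refine Prod.ext ?_ (funext fun i => ?_)
  · simpa [coeff_zero_index] using hp 0 (by simp)
  · rw [← p.coeff_natCast_add_one]
    exact hp _ (by rw [Finset.mem_Icc]; omega)

theorem coeff_mk_of_conj_eq {a : ℤ → ℂ} (ha : ∀ k, conj (a k) = a (-k)) {k : ℤ}
    (hk : k ∈ Finset.Icc (-(n : ℤ)) n) :
    HermCoeffs.coeff (n := n) ((a 0).re, fun i => a ((i : ℤ) + 1)) k = a k := by
  rw [Finset.mem_Icc] at hk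
  have hpos (l : ℤ) (hl : 0 < l) (hln : l ≤ n) :
      HermCoeffs.coeff (n := n) ((a 0).re, fun i => a ((i : ℤ) + 1)) l = a l := by
    obtain ⟨i, rfl⟩ : ∃ i : Fin n, l = (i : ℤ) + 1 := ⟨⟨(l - 1).toNat, by omega⟩, by simp; omega⟩
    rw [coeff_natCast_add_one]
  rcases lt_trichotomy k 0 with hneg | rfl | hk0
  · rw [← neg_neg k, ← conj_coeff, hpos (-k) (by omega) (by omega), ha]
  · rw [coeff_zero_index]
    exact Complex.conj_eq_iff_re.1 (ha 0)
  · exact hpos k hk0 hk.2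

theorem eval_add (p q : HermCoeffs n) (z : ℂ) : (p + q).eval z = p.eval z + q.eval z := by
  simp only [eval, coeff_add, add_mul, Finset.sum_add_distrib]

theorem eval_smul (a : ℝ) (p : HermCoeffs n) (z : ℂ) : (a • p).eval z = a * p.eval z := by
  simp only [eval, coeff_smul, mul_assoc, Finset.mul_sum]

theorem conj_eval (p : HermCoeffs n) {z : ℂ} (hz : ‖z‖ = 1) : conj (p.eval z) = p.eval z :=
  Complex.conj_eq_iff_im.2 (p.eval_im hz)

theorem ofReal_re_eval (p : HermCoeffs n) {z : ℂ} (hz : ‖z‖ = 1) :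
    ((p.eval z).re : ℂ) = p.eval z :=
  Complex.conj_eq_iff_re.1 (p.conj_eval hz)

/-- The polynomial `z ^ n * p(z)`, which has the same zeros on `z ≠ 0` as `p`. -/
def toPolynomial (p : HermCoeffs n) : Polynomial ℂ :=
  ∑ k ∈ Finset.Icc (-(n : ℤ)) n, Polynomial.monomial (n - k).toNat (p.coeff k)

theorem eval_toPolynomial (p : HermCoeffs n) {z : ℂ} (hz : z ≠ 0) :
    p.toPolynomial.eval z = z ^ n * p.eval z := by
  rw [toPolynomial, Polynomial.eval_finsetSum, eval, Finset.mul_sum]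
  refine Finset.sum_congr rfl fun k hk => ?_
  have hexp : (((n - k).toNat : ℕ) : ℤ) = n + -k := by
    rw [Finset.mem_Icc] at hk
    omega
  rw [Polynomial.eval_monomial, ← zpow_natCast, hexp, zpow_add₀ hz, zpow_natCast, mul_left_comm]

theorem natDegree_toPolynomial_le (p : HermCoeffs n) : p.toPolynomial.natDegree ≤ 2 * n := by
  refine Polynomial.natDegree_sum_le_of_forall_le _ _ fun k hk => ?_
  refine (Polynomial.natDegree_monomial_le _).trans ?_
  rw [Finset.mem_Icc] at hk
  omega

theorem coeff_toPolynomial (p : HermCoeffs n) {k : ℤ} (hk : k ∈ Finset.Icc (-(n : ℤ)) n) :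
    p.toPolynomial.coeff (n - k).toNat = p.coeff k := by
  rw [toPolynomial, Polynomial.finsetSum_coeff, Finset.sum_eq_single_of_mem k hk,
    Polynomial.coeff_monomial, if_pos rfl]
  intro l hl hlk
  rw [Finset.mem_Icc] at hk hl
  exact Polynomial.coeff_monomial_of_ne _ (by omega)

theorem eq_zero_of_eval_eq_zero {p : HermCoeffs n} {s : Finset ℂ} (hs : 0 ∉ s)
    (hp : ∀ z ∈ s, p.eval z = 0) (hcard : 2 * n < s.card) : p = 0 := by
  have hpoly : p.toPolynomial = 0 :=
    Polynomial.eq_zero_of_natDegree_lt_card_of_eval_eq_zero' _ s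
      (fun z hz => by rw [p.eval_toPolynomial (ne_of_mem_of_not_mem hz hs), hp z hz, mul_zero])
      (p.natDegree_toPolynomial_le.trans_lt hcard)
  refine eq_zero_of_coeff_eq_zero fun k hk => ?_
  rw [← p.coeff_toPolynomial hk, hpoly, Polynomial.coeff_zero]

/-- Evaluation at `z` as a functional. The real part is the value itself when `‖z‖ = 1`. -/
def evalCLM (z : ℂ) : StrongDual ℝ (HermCoeffs n) :=
  LinearMap.toContinuousLinearMap
    { toFun := fun p => (p.eval z).re
      map_add' := fun p q => by rw [eval_add, Complex.add_re]
      map_smul' := fun a p => by rw [eval_smul, Complex.re_ofReal_mul]; rfl }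

/-- The pairing `⟨c, p⟩` as an operator from the covariance data to the functionals. -/
def pairingCLM : HermCoeffs n →L[ℝ] StrongDual ℝ (HermCoeffs n) :=
  LinearMap.toContinuousBilinearMap <| LinearMap.mk₂ ℝ (fun c p => (pairing c p).re)
    (fun c c' p => by
      simp only [pairing, coeff_add, add_mul, Finset.sum_add_distrib, Complex.add_re])
    (fun a c p => by
      simp only [pairing, coeff_smul, mul_assoc, ← Finset.mul_sum, Complex.re_ofReal_mul,
        smul_eq_mul])
    (fun c p p' => by
      simp only [pairing, coeff_add, map_add, mul_add, Finset.sum_add_distrib, Complex.add_re])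
    (fun a c p => by
      simp only [pairing, coeff_smul, map_mul, Complex.conj_ofReal, mul_left_comm _ (a : ℂ),
        ← Finset.mul_sum, Complex.re_ofReal_mul, smul_eq_mul])

theorem pairingCLM_apply (c p : HermCoeffs n) : pairingCLM c p = (pairing c p).re := rfl

theorem eq_zero_of_pairing_self {p : HermCoeffs n} (hp : (pairing p p).re = 0) : p = 0 := by
  have hsum : ∑ k ∈ Finset.Icc (-(n : ℤ)) n, Complex.normSq (p.coeff k) = 0 := by
    simpa only [pairing, Complex.mul_conj, Complex.re_sum, Complex.ofReal_re] using hp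
  rw [Finset.sum_eq_zero_iff_of_nonneg fun _ _ => Complex.normSq_nonneg _] at hsum
  exact eq_zero_of_coeff_eq_zero fun k hk => Complex.normSq_eq_zero.1 (hsum k hk)

theorem isInvertible_pairingCLM : (pairingCLM (n := n)).IsInvertible :=
  isInvertible_of_forall_apply_self_eq_zero _ fun _ => eq_zero_of_pairing_self

end HermCoeffs

section Circle

theorem zetaPt_injOn (N : ℕ) : InjOn (zetaPt N) (Finset.Icc (-(N : ℤ) + 1) N : Finset ℤ) := by
  have him (j : ℤ) : (Complex.I * (Real.pi * j / N)).im = Real.pi * (j / N) := by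
    rw [mul_comm, Complex.mul_I_im, mul_div_assoc]
    norm_cast
  have hbounds {j : ℤ} (hj : j ∈ Finset.Icc (-(N : ℤ) + 1) N) :
      -Real.pi < Real.pi * (j / N) ∧ Real.pi * (j / N) ≤ Real.pi := by
    rw [Finset.mem_Icc] at hj
    have hN : (0 : ℝ) < N := by exact_mod_cast (by omega : 0 < N)
    have hlower : -1 < (j / N : ℝ) := by
      rw [lt_div_iff₀ hN]
      exact_mod_cast (by omega : -1 * (N : ℤ) < j)
    have hupper : (j / N : ℝ) ≤ 1 := by
      rw [div_le_one hN]
      exact_mod_cast hj.2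
    constructor <;> nlinarith [Real.pi_pos]
  intro j hj k hk hjk
  have harg := Complex.exp_inj_of_neg_pi_lt_of_le_pi (him j ▸ (hbounds hj).1)
    (him j ▸ (hbounds hj).2) (him k ▸ (hbounds hk).1) (him k ▸ (hbounds hk).2) hjk
  have hN : (N : ℝ) ≠ 0 := by
    have := Finset.mem_Icc.1 hj
    exact_mod_cast (by omega : N ≠ 0)
  have him_eq := congrArg Complex.im harg
  rw [him, him, mul_right_inj' Real.pi_ne_zero, div_left_inj' hN] at him_eq
  exact_mod_cast him_eq

variable {n N : ℕ}

variable (n N) in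
/-- The evaluations at the points `ζ_j`, scaled by the mass `1 / 2N` of each point. The scaling
leaves the cone and the ratios `P / Q` unchanged, and makes `momentFunctional` a `ν`-integral. -/
def circleEval (j : Finset.Icc (-(N : ℤ) + 1) N) : StrongDual ℝ (HermCoeffs n) :=
  (1 / (2 * N) : ℝ) • HermCoeffs.evalCLM (zetaPt N j)

theorem circleEval_apply (j : Finset.Icc (-(N : ℤ) + 1) N) (p : HermCoeffs n) :
    circleEval n N j p = 1 / (2 * N) * (p.eval (zetaPt N j)).re := rfl

theorem eq_zero_of_circleEval_eq_zero (hnN : n < N) {p : HermCoeffs n}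
    (hp : ∀ j, circleEval n N j p = 0) : p = 0 := by
  have hN : (N : ℝ) ≠ 0 := by exact_mod_cast (Nat.zero_le n).trans_lt hnN |>.ne'
  refine HermCoeffs.eq_zero_of_eval_eq_zero
    (s := (Finset.Icc (-(N : ℤ) + 1) N).image (zetaPt N)) ?_ ?_ ?_
  · simp [zetaPt]
  · refine Finset.forall_mem_image.2 fun j hj => ?_
    have hre := hp ⟨j, hj⟩
    rw [circleEval_apply, mul_eq_zero, or_iff_right (by simpa using hN)] at hre
    rw [← p.ofReal_re_eval (norm_zetaPt N j), hre, Complex.ofReal_zero]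
  · rw [Finset.card_image_of_injOn (zetaPt_injOn N), Int.card_Icc]
    omega

theorem positiveCone_circleEval (hN : 0 < N) : positiveCone (circleEval n N) = posCone n N := by
  have hscale : (0 : ℝ) < 1 / (2 * N) := by positivity
  ext P
  simp only [positiveCone, posCone, mem_ofPred_eq, Subtype.forall, circleEval_apply,
    mul_pos_iff_of_pos_left hscale]

theorem preimage_strictDual_posCone :
    HermCoeffs.pairingCLM ⁻¹' strictDual (posCone n N) = dualCone n N := rfl

theorem conj_ratMoment (P Q : HermCoeffs n) (k : ℤ) :
    conj (ratMoment N P Q k) = ratMoment N P Q (-k) := by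
  simp only [ratMoment, discreteIntegral, map_mul, map_sum, map_div₀, map_zpow₀, map_one,
    map_ofNat, Complex.conj_natCast, HermCoeffs.conj_eval _ (norm_zetaPt N _),
    ← Complex.inv_eq_conj (norm_zetaPt N _), inv_zpow']

theorem coeff_momentMap (P Q : HermCoeffs n) {k : ℤ} (hk : k ∈ Finset.Icc (-(n : ℤ)) n) :
    (momentMap N P Q).coeff k = ratMoment N P Q k :=
  HermCoeffs.coeff_mk_of_conj_eq (conj_ratMoment P Q) hk

theorem pairing_momentMap (P Q R : HermCoeffs n) :
    pairing (momentMap N P Q) R =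
      discreteIntegral N fun z => P.eval z / Q.eval z * R.eval z := by
  have hR (j : ℤ) : R.eval (zetaPt N j) =
      ∑ k ∈ Finset.Icc (-(n : ℤ)) n, conj (R.coeff k) * zetaPt N j ^ k := by
    rw [← R.conj_eval (norm_zetaPt N j), HermCoeffs.eval, map_sum]
    simp only [map_mul, map_zpow₀, ← Complex.inv_eq_conj (norm_zetaPt N j), inv_zpow', neg_neg]
  calc pairing (momentMap N P Q) R
      = ∑ k ∈ Finset.Icc (-(n : ℤ)) n, ratMoment N P Q k * conj (R.coeff k) :=
        Finset.sum_congr rfl fun k hk => by rw [coeff_momentMap P Q hk]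
    _ = discreteIntegral N fun z => P.eval z / Q.eval z * R.eval z := by
        simp only [ratMoment, discreteIntegral, hR, Finset.mul_sum, Finset.sum_mul]
        rw [Finset.sum_comm]
        refine Finset.sum_congr rfl fun j _ => Finset.sum_congr rfl fun k _ => ?_
        ring

theorem pairingCLM_momentMap (hN : N ≠ 0) (P Q : HermCoeffs n) :
    HermCoeffs.pairingCLM (momentMap N P Q) = momentFunctional (circleEval n N) P Q := by
  have hscale : (1 / (2 * N) : ℝ) ≠ 0 := by positivity
  refine ContinuousLinearMap.ext fun R => ?_
  have hreal : pairing (momentMap N P Q) R =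
      ((momentFunctional (circleEval n N) P Q R : ℝ) : ℂ) := by
    rw [pairing_momentMap, discreteIntegral, Finset.mul_sum,
      ← Finset.sum_coe_sort (Finset.Icc (-(N : ℤ) + 1) N)]
    simp only [momentFunctional, sum_apply, smul_apply, smul_eq_mul, circleEval_apply,
      mul_div_mul_left _ _ hscale]
    push_cast
    simp only [HermCoeffs.ofReal_re_eval _ (norm_zetaPt N _)]
    exact Finset.sum_congr rfl fun j _ => mul_left_comm _ _ _
  rw [HermCoeffs.pairingCLM_apply, hreal, Complex.ofReal_re]

theorem isContDiffDiffeoOn_momentMap (hnN : n < N) {m : WithTop ℕ∞} (hm : m ≠ 0)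
    {P : HermCoeffs n} (hP : P ∈ posCone n N) :
    IsContDiffDiffeoOn ℝ m (momentMap N P) (posCone n N) (dualCone n N) := by
  have hN : 0 < N := (Nat.zero_le n).trans_lt hnN
  obtain ⟨T, hT⟩ := HermCoeffs.isInvertible_pairingCLM (n := n)
  have hcomp : T ∘ momentMap N P = momentFunctional (circleEval n N) P := by
    funext Q
    rw [← pairingCLM_momentMap hN.ne', ← hT]
    rfl
  have hdiffeo := isContDiffDiffeoOn_momentFunctional
    (fun _ => eq_zero_of_circleEval_eq_zero hnN) hm ((positiveCone_circleEval hN).ge hP)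
  rw [positiveCone_circleEval hN, ← hcomp] at hdiffeo
  rw [← preimage_strictDual_posCone, ← hT]
  exact hdiffeo.of_equiv_comp T

theorem bijOn_momentMap (hnN : n < N) {P : HermCoeffs n} (hP : P ∈ posCone n N) :
    BijOn (momentMap N P) (posCone n N) (dualCone n N) :=
  (isContDiffDiffeoOn_momentMap hnN one_ne_zero hP).bijOn

theorem eq_solutionMap_iff (hnN : n < N) {c P : HermCoeffs n} (hc : c ∈ dualCone n N)
    (hP : P ∈ posCone n N) {Q : HermCoeffs n} :
    (Q ∈ posCone n N ∧ momentMap N P Q = c) ↔ Q = solutionMap n N c P := by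
  obtain ⟨-, hinj, hsurj⟩ := bijOn_momentMap hnN hP
  have hmem : solutionMap n N c P ∈ posCone n N := Function.invFunOn_mem (hsurj hc)
  have hmoment : momentMap N P (solutionMap n N c P) = c := Function.invFunOn_eq (hsurj hc)
  constructor
  · rintro ⟨hQ, hQc⟩
    exact hinj hQ hmem (hQc.trans hmoment.symm)
  · rintro rfl
    exact ⟨hmem, hmoment⟩

theorem isContDiffDiffeoOn_solutionMap (hnN : n < N) {m : WithTop ℕ∞} (hm : m ≠ 0)
    {c : HermCoeffs n} (hc : c ∈ dualCone n N) :
    IsContDiffDiffeoOn ℝ m (solutionMap n N c) (posCone n N) (solutionSet n N c) := by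
  have hN : 0 < N := (Nat.zero_le n).trans_lt hnN
  have hmoment (P Q : HermCoeffs n) : momentFunctional (circleEval n N) P Q =
      HermCoeffs.pairingCLM c ↔ momentMap N P Q = c := by
    obtain ⟨T, hT⟩ := HermCoeffs.isInvertible_pairingCLM (n := n)
    rw [← pairingCLM_momentMap hN.ne', ← hT]
    exact T.injective.eq_iff
  have hdiffeo := isContDiffDiffeoOn_of_momentFunctional_eq (φ := HermCoeffs.pairingCLM c)
    (G := solutionMap n N c) (fun _ => eq_zero_of_circleEval_eq_zero hnN) hm
  simp only [positiveCone_circleEval hN, hmoment] at hdiffeo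
  exact hdiffeo hc fun P hP => (eq_solutionMap_iff hnN hc hP).2 rfl

end Circle

end

theorem mainTheorem2 (n N : ℕ) (hnN : n < N) :
    (∀ P ∈ posCone n N,
      ∃ e : OpenPartialHomeomorph (HermCoeffs n) (HermCoeffs n),
        e.source = posCone n N ∧ e.target = dualCone n N ∧
        (∀ Q ∈ posCone n N, e Q = momentMap N P Q) ∧
        ContDiffOn ℝ ∞ e e.source ∧ ContDiffOn ℝ ∞ e.symm e.target) ∧
    (∀ c ∈ dualCone n N,
      (∀ P ∈ posCone n N, ∀ Q,
        (Q ∈ posCone n N ∧ momentMap N P Q = c) ↔ Q = solutionMap n N c P) ∧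
      ∃ e : OpenPartialHomeomorph (HermCoeffs n) (HermCoeffs n),
        e.source = posCone n N ∧ e.target = solutionSet n N c ∧
        (∀ P ∈ posCone n N, e P = solutionMap n N c P) ∧
        ContDiffOn ℝ ∞ e e.source ∧ ContDiffOn ℝ ∞ e.symm e.target) := by
  exact ⟨fun P hP => isContDiffDiffeoOn_momentMap hnN (by simp) hP,
    fun c hc => ⟨fun P hP Q => eq_solutionMap_iff hnN hc hP,
      isContDiffDiffeoOn_solutionMap hnN (by simp) hc⟩⟩
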